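/- Let $k$ be an algebraically closed field of characteristic $p>0$ and let $d\ge 1$. Let $\mathcal H_d$ be the Hirzebruch surface of index $d$, that is, the $\mathbb P^1$-bundle over $\mathbb P^1$ associated to $\mathcal O_{\mathbb P^1}\oplus\mathcal O_{\mathbb P^1}(d)$, presented as the union of the four affine planes with coordinate rings $k[x,y]$, $k[x^dy,1/x]$, $k[1/x,1/(x^dy)]$ and $k[1/y,x]$, glued inside the common function field $k(\mathcal H_d)=k(x,y)$. For a nonzero rational vector field $\delta\in\mathrm{Der}_k\,k(\mathcal H_d)$, write $\delta=\alpha\,(f\,\partial/\partial s+g\,\partial/\partial t)$ on each of these planes, where $s,t$ are its coordinates, $f,g$ are regular functions on it without common factors, and $\alpha\in k(\mathcal H_d)^\times$. Let $\mathrm{div}(\delta)$ be the divisor obtained by glueing the divisors $\mathrm{div}(\alpha)$, and let $\mathcal O_{\mathcal H_d}(\mathrm{div}(\delta))$ be the associated invertible sheaf (whose sections on each plane are the quotients $h/\alpha$ with $h$ regular there); when $\delta$ is $p$-closed, it is the invertible $1$-foliation corresponding to $\delta$. Two rational vector fields $\delta,\delta'$ are called equivalent, $\delta\sim\delta'$,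 if $\delta=\beta\delta'$ for some nonzero $\beta\in k(\mathcal H_d)$. Suppose that $\mathcal O_{\mathcal H_d}(\mathrm{div}(\delta))$ has a nonzero global section. Then there are $a_0,a_1,a_2,b\in k$ and $F\in k[x]$ with $\deg F\le d$ such that $$\delta\sim(a_2x^2+a_1x+a_0)\frac{\partial}{\partial x}+\bigl(F(x)\,y-d\,a_2\,x+b\bigr)\,y\,\frac{\partial}{\partial y}.$$ -/

import Mathlib

noncomputable section

namespace Hirzebruch

/-- The function field `k(x, y)` of the Hirzebruch surface. -/
abbrev RatFun (k : Type*) [Field k] : Type _ := FractionRing (MvPolynomial (Fin 2) k)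

/-- The rational function `x`. -/
def x (k : Type*) [Field k] : RatFun k := algebraMap (MvPolynomial (Fin 2) k) _ (MvPolynomial.X 0)

/-- The rational function `y`. -/
def y (k : Type*) [Field k] : RatFun k := algebraMap (MvPolynomial (Fin 2) k) _ (MvPolynomial.X 1)

/-- The coordinates of the four standard affine planes covering the Hirzebruch surface of index
`d`, as elements of the function field: `(x, y)`, `(z, w) = (x ^ d y, 1 / x)`,
`(s, t) = (1 / x, 1 / (x ^ d y))` and `(u, v) = (1 / y, x)`. -/
def coord (k : Type*) [Field k] (d : ℕ) : Fin 4 → Fin 2 → RatFun k :=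
  ![![x k, y k],
    ![x k ^ d * y k, (x k)⁻¹],
    ![(x k)⁻¹, (x k ^ d * y k)⁻¹],
    ![(y k)⁻¹, x k]]

/-- The affine coordinate ring of the `i`-th standard affine open `U i`. The Hirzebruch surface
of index `d` is the integral separated surface with function field `k(x, y)` obtained by glueing
the four planes `U i = Spec (chart k d i)` inside this common function field. -/
def chart (k : Type*) [Field k] (d : ℕ) (i : Fin 4) : Subalgebra k (RatFun k) :=
  Algebra.adjoin k (Set.range (coord k d i))

/-- The coordinate ring of the affine open `U i ∩ U j`: it is generated by the coordinate rings
of `U i` and `U j`, since the surface is separated. -/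
def overlap (k : Type*) [Field k] (d : ℕ) (i j : Fin 4) : Subalgebra k (RatFun k) :=
  chart k d i ⊔ chart k d j

/-- A (Cartier) divisor on the Hirzebruch surface, given by a nonzero rational function on each
`U i` (its local equation there), such that on `U i ∩ U j` the local equations differ by
a unit. Every divisor is of this form, since every divisor on an affine plane is principal. -/
structure Divisor (k : Type*) [Field k] (d : ℕ) where
  /-- The local equation on `U i`. -/
  eqn : Fin 4 → RatFun k
  eqn_ne_zero : ∀ i, eqn i ≠ 0
  /-- With `i` and `j` exchanged, this also gives that the inverse is regular. -/
  eqn_div_mem : ∀ i j, eqn i / eqn j ∈ overlap k d i j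

/-- The sections over `U i` of the invertible sheaf `O(D)`, as a subsheaf of the constant sheaf
of rational functions: the quotients `h / α` with `h` regular on `U i`, where `α` is the local
equation of `D` on `U i`. -/
def Divisor.sectionsOn {k : Type*} [Field k] {d : ℕ} (D : Divisor k d) (i : Fin 4) :
    Submodule k (RatFun k) where
  carrier := {φ | ∃ h ∈ chart k d i, φ = h / D.eqn i}
  zero_mem' := ⟨0, zero_mem _, by simp⟩
  add_mem' := by
    rintro _ _ ⟨a, ha, rfl⟩ ⟨b, hb, rfl⟩
    exact ⟨a + b, add_mem ha hb, by rw [add_div]⟩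
  smul_mem' := by
    rintro c _ ⟨a, ha, rfl⟩
    exact ⟨c • a, Subalgebra.smul_mem _ ha c, by rw [smul_div_assoc]⟩

/-- The space `H⁰(O(D))` of global sections of `O(D)`. -/
def Divisor.globalSections {k : Type*} [Field k] {d : ℕ} (D : Divisor k d) :
    Submodule k (RatFun k) :=
  ⨅ i, D.sectionsOn i

/-- A rational vector field: a `k`-derivation of the function field. -/
abbrev VectorField (k : Type*) [Field k] : Type _ := Derivation k (RatFun k) (RatFun k)

/-- Two rational vector fields are equivalent if they differ by a nonzero rational function. -/
def Equivalent {k : Type*} [Field k] (δ δ' : VectorField k) : Prop :=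
  ∃ α : RatFun k, α ≠ 0 ∧ δ = α • δ'

/-- `α` is a local equation of `div δ` on `U i`: in the coordinates `s, t` of `U i` one has
`δ = α (f ∂/∂s + g ∂/∂t)` with `f`, `g` regular on `U i` without common factors. (The coefficients
of a derivation `δ` in `∂/∂s` and `∂/∂t` are `δ s` and `δ t`.) -/
def IsLocalEquation {k : Type*} [Field k] (d : ℕ) (δ : VectorField k) (i : Fin 4)
    (α : RatFun k) : Prop :=
  α ≠ 0 ∧ ∃ f g : chart k d i, IsRelPrime f g ∧
    δ (coord k d i 0) = α * f ∧ δ (coord k d i 1) = α * g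

/-- `D` is the divisor associated to `δ`. -/
def IsDivisorOf {k : Type*} [Field k] {d : ℕ} (δ : VectorField k) (D : Divisor k d) : Prop :=
  ∀ i, IsLocalEquation d δ i (D.eqn i)

section WellDefined

variable {k : Type*} [Field k]

theorem x_ne_zero : x k ≠ 0 := by
  simp [x]

theorem y_ne_zero : y k ≠ 0 := by
  simp [y]

theorem coord_ne_zero (d : ℕ) (i : Fin 4) (j : Fin 2) : coord k d i j ≠ 0 := by
  have hx := x_ne_zero (k := k)
  have hy := y_ne_zero (k := k)
  fin_cases i <;> fin_cases j <;> simp [coord, hx, hy]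

theorem coord_mem (d : ℕ) (i : Fin 4) (j : Fin 2) : coord k d i j ∈ chart k d i :=
  Algebra.subset_adjoin ⟨j, rfl⟩

theorem adjoin_x_y : IntermediateField.adjoin k {x k, y k} = ⊤ := by
  rw [eq_top_iff]
  intro a _
  obtain ⟨p, q, -, rfl⟩ := IsFractionRing.div_surjective (A := MvPolynomial (Fin 2) k) a
  have key : ∀ p : MvPolynomial (Fin 2) k, algebraMap _ (RatFun k) p ∈
      IntermediateField.adjoin k {x k, y k} := by
    intro p
    induction p using MvPolynomial.induction_on with
    | C c =>
      have : algebraMap (MvPolynomial (Fin 2) k) (RatFun k) (MvPolynomial.C c)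
          = algebraMap k (RatFun k) c := by
        rw [IsScalarTower.algebraMap_apply k (MvPolynomial (Fin 2) k) (RatFun k)]
        rfl
      rw [this]
      exact IntermediateField.algebraMap_mem _ c
    | add p q hp hq => rw [map_add]; exact add_mem hp hq
    | mul_X p i hp =>
      rw [map_mul]
      refine mul_mem hp (IntermediateField.subset_adjoin _ _ ?_)
      fin_cases i
      · exact Or.inl rfl
      · exact Or.inr rfl
  exact div_mem (key p) (key q)

theorem adjoin_coord (d : ℕ) (i : Fin 4) :
    IntermediateField.adjoin k (Set.range (coord k d i)) = ⊤ := by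
  rw [eq_top_iff, ← adjoin_x_y, IntermediateField.adjoin_le_iff]
  set L := IntermediateField.adjoin k (Set.range (coord k d i)) with hL
  have h0 : coord k d i 0 ∈ L := IntermediateField.subset_adjoin _ _ ⟨0, rfl⟩
  have h1 : coord k d i 1 ∈ L := IntermediateField.subset_adjoin _ _ ⟨1, rfl⟩
  have hx0 := x_ne_zero (k := k)
  have hy0 := y_ne_zero (k := k)
  clear_value L
  have : x k ∈ L ∧ y k ∈ L := by
    fin_cases i <;> simp only [coord, Fin.zero_eta, Fin.mk_one, Fin.reduceFinMk,
      Matrix.cons_val, Matrix.cons_val_zero, Matrix.cons_val_one] at h0 h1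
    · exact ⟨h0, h1⟩
    · have hx : x k ∈ L := by simpa using inv_mem h1
      refine ⟨hx, ?_⟩
      have := div_mem h0 (pow_mem hx d)
      rwa [mul_div_cancel_left₀ _ (pow_ne_zero _ hx0)] at this
    · have hx : x k ∈ L := by simpa using inv_mem h0
      refine ⟨hx, ?_⟩
      have := div_mem (inv_mem h1) (pow_mem hx d)
      rwa [inv_inv, mul_div_cancel_left₀ _ (pow_ne_zero _ hx0)] at this
    · exact ⟨h1, by simpa using inv_mem h0⟩
  rintro a (rfl | rfl)
  exacts [this.1, this.2]

theorem exists_div (d : ℕ) (i : Fin 4) (a : RatFun k) :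
    ∃ r ∈ chart k d i, ∃ s ∈ chart k d i, s ≠ 0 ∧ a = r / s := by
  have ha : a ∈ IntermediateField.adjoin k (Set.range (coord k d i)) := by
    rw [adjoin_coord]; trivial
  obtain ⟨r, hr, s, hs, h⟩ := IntermediateField.mem_adjoin_iff_div.1 ha
  by_cases h0 : s = 0
  · exact ⟨0, zero_mem _, 1, one_mem _, one_ne_zero, by simp [h, h0]⟩
  · exact ⟨r, hr, s, hs, h0, h⟩

instance isFractionRing_chart (d : ℕ) (i : Fin 4) : IsFractionRing (chart k d i) (RatFun k) := by
  refine IsFractionRing.of_field _ _ fun a => ?_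
  obtain ⟨r, hr, s, hs, h0, h⟩ := exists_div d i a
  exact ⟨⟨r, hr⟩, ⟨s, hs⟩, h⟩

theorem trdeg_ratFun : Algebra.trdeg k (RatFun k) = 2 := by
  have h : IsTranscendenceBasis k (fun i : Fin 2 => algebraMap (MvPolynomial (Fin 2) k) (RatFun k)
      (MvPolynomial.X i)) := by
    have hb := IsTranscendenceBasis.mvPolynomial (Fin 2) k
    have : Algebra.IsAlgebraic (MvPolynomial (Fin 2) k) (RatFun k) :=
      IsLocalization.isAlgebraic _ (nonZeroDivisors (MvPolynomial (Fin 2) k))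
    exact hb.algebraMap_comp (A := RatFun k)
  have := h.lift_cardinalMk_eq_trdeg
  simpa using this.symm

theorem algebraicIndependent_coord (d : ℕ) (i : Fin 4) :
    AlgebraicIndependent k (coord k d i) := by
  have : Algebra.IsAlgebraic (Algebra.adjoin k (Set.range (coord k d i))) (RatFun k) :=
    haveI : IsFractionRing (Algebra.adjoin k (Set.range (coord k d i))) (RatFun k) :=
      isFractionRing_chart d i
    IsLocalization.isAlgebraic _
      (nonZeroDivisors (Algebra.adjoin k (Set.range (coord k d i))))
  exact (Algebra.IsAlgebraic.isTranscendenceBasis_of_lift_le_trdeg_of_finite k (coord k d i)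
    (by rw [trdeg_ratFun]; simp)).1

instance ufd_chart (d : ℕ) (i : Fin 4) : UniqueFactorizationMonoid (chart k d i) :=
  ((algebraicIndependent_coord (k := k) d i).aevalEquiv.toMulEquiv).uniqueFactorizationMonoid
    inferInstance

/-- A derivation that vanishes on the coordinates of a chart is zero. -/
theorem eq_zero_of_coord (d : ℕ) (i : Fin 4) (δ : VectorField k)
    (h0 : δ (coord k d i 0) = 0) (h1 : δ (coord k d i 1) = 0) : δ = 0 := by
  have key : ∀ r ∈ chart k d i, δ r = 0 := by
    intro r hr
    induction hr using Algebra.adjoin_induction with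
    | mem a ha =>
      obtain ⟨j, rfl⟩ := ha
      fin_cases j
      exacts [h0, h1]
    | algebraMap c => simp
    | add a b _ _ ha hb => simp [ha, hb]
    | mul a b _ _ ha hb => simp [ha, hb]
  ext a
  obtain ⟨r, hr, s, hs, hs0, rfl⟩ := exists_div d i a
  simp [Derivation.leibniz_div, key r hr, key s hs]

theorem exists_isLocalEquation (d : ℕ) (i : Fin 4) {δ : VectorField k} (hδ : δ ≠ 0) :
    ∃ α, IsLocalEquation d δ i α := by
  obtain ⟨r, hr, s, hs, hs0, h0⟩ := exists_div d i (δ (coord k d i 0))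
  obtain ⟨r', hr', s', hs', hs0', h1⟩ := exists_div d i (δ (coord k d i 1))
  let _ : GCDMonoid (chart k d i) := UniqueFactorizationMonoid.toGCDMonoid _
  let A : chart k d i := ⟨r * s', mul_mem hr hs'⟩
  let B : chart k d i := ⟨r' * s, mul_mem hr' hs⟩
  obtain ⟨f, g, hA, hB, hu⟩ := extract_gcd A B
  have hA' : r * s' = (gcd A B : chart k d i) * (f : RatFun k) := congrArg Subtype.val hA
  have hB' : r' * s = (gcd A B : chart k d i) * (g : RatFun k) := congrArg Subtype.val hB
  have e0 : δ (coord k d i 0) = (gcd A B : chart k d i) / (s * s') * (f : RatFun k) := by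
    rw [h0]; field_simp; linear_combination hA'
  have e1 : δ (coord k d i 1) = (gcd A B : chart k d i) / (s * s') * (g : RatFun k) := by
    rw [h1]; field_simp; linear_combination hB'
  refine ⟨(gcd A B : chart k d i) / (s * s'), ?_, f, g, ?_, e0, e1⟩
  · intro hz
    exact hδ (eq_zero_of_coord d i δ (by rw [e0, hz, zero_mul]) (by rw [e1, hz, zero_mul]))
  · intro c hf hg
    exact isUnit_of_dvd_unit (dvd_gcd hf hg) hu

theorem monomial_mem {d : ℕ} {i : Fin 4} {R : Subalgebra k (RatFun k)} (h : chart k d i ≤ R)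
    (a b : ℕ) : coord k d i 0 ^ a * coord k d i 1 ^ b ∈ R :=
  mul_mem (pow_mem (h (coord_mem d i 0)) a) (pow_mem (h (coord_mem d i 1)) b)

theorem basic_open_aux (d : ℕ) (i j : Fin 4) (e e' a b a' b' n p q n' p' q' : ℕ)
    (hm : (coord k d j 0 ^ e * coord k d j 1 ^ e')⁻¹ =
      coord k d i 0 ^ a * coord k d i 1 ^ b * (coord k d j 0 ^ a' * coord k d j 1 ^ b'))
    (h0 : (coord k d j 0 ^ e * coord k d j 1 ^ e') ^ n * coord k d i 0 =
      coord k d j 0 ^ p * coord k d j 1 ^ q)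
    (h1 : (coord k d j 0 ^ e * coord k d j 1 ^ e') ^ n' * coord k d i 1 =
      coord k d j 0 ^ p' * coord k d j 1 ^ q') :
    ∃ m ∈ chart k d j, m ≠ 0 ∧
      m⁻¹ ∈ overlap k d i j ∧ ∀ r ∈ overlap k d i j, ∃ n : ℕ, m ^ n * r ∈ chart k d j := by
  have hmem : coord k d j 0 ^ e * coord k d j 1 ^ e' ∈ chart k d j := monomial_mem le_rfl e e'
  refine ⟨coord k d j 0 ^ e * coord k d j 1 ^ e', hmem,
    mul_ne_zero (pow_ne_zero _ (coord_ne_zero d j 0)) (pow_ne_zero _ (coord_ne_zero d j 1)),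
    ?_, ?_⟩
  · rw [hm]
    exact mul_mem (monomial_mem le_sup_left a b) (monomial_mem le_sup_right a' b')
  · generalize coord k d j 0 ^ e * coord k d j 1 ^ e' = m at *
    intro r hr
    rw [overlap, chart, chart, ← Algebra.adjoin_union] at hr
    induction hr using Algebra.adjoin_induction with
    | mem r hr =>
      rcases hr with ⟨c, rfl⟩ | ⟨c, rfl⟩
      · fin_cases c
        · exact ⟨n, h0 ▸ monomial_mem le_rfl p q⟩
        · exact ⟨n', h1 ▸ monomial_mem le_rfl p' q'⟩
      · exact ⟨0, by simpa using coord_mem d j c⟩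
    | algebraMap c => exact ⟨0, by simp⟩
    | add r s _ _ hr hs =>
      obtain ⟨n, hn⟩ := hr
      obtain ⟨l, hl⟩ := hs
      refine ⟨n + l, ?_⟩
      have : m ^ (n + l) * (r + s) = m ^ l * (m ^ n * r) + m ^ n * (m ^ l * s) := by ring
      rw [this]
      exact add_mem (mul_mem (pow_mem hmem l) hn) (mul_mem (pow_mem hmem n) hl)
    | mul r s _ _ hr hs =>
      obtain ⟨n, hn⟩ := hr
      obtain ⟨l, hl⟩ := hs
      refine ⟨n + l, ?_⟩
      have : m ^ (n + l) * (r * s) = (m ^ n * r) * (m ^ l * s) := by ring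
      rw [this]
      exact mul_mem hn hl

/-- `U i ∩ U j` is the basic open subset of `U j` where some `m` does not vanish. -/
theorem exists_basic_open (d : ℕ) (i j : Fin 4) : ∃ m ∈ chart k d j, m ≠ 0 ∧
    m⁻¹ ∈ overlap k d i j ∧ ∀ r ∈ overlap k d i j, ∃ n : ℕ, m ^ n * r ∈ chart k d j := by
  have hx := x_ne_zero (k := k)
  have hy := y_ne_zero (k := k)
  by_cases hij : i = j
  · subst hij
    exact ⟨1, one_mem _, one_ne_zero, by simp, fun r hr => ⟨0, by simpa [overlap] using hr⟩⟩
  fin_cases i <;> fin_cases j <;> first | exact absurd rfl hij | skip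
  · refine basic_open_aux d 0 1  0 1  1 0 0 0  1 0 0  0 1 d ?_ ?_ ?_
    all_goals simp [coord]
    all_goals try field_simp
  · refine basic_open_aux d 0 2  1 1  (d + 1) 1 0 0  1 0 1  1 (d + 1) 0 ?_ ?_ ?_
    all_goals simp [coord]
    all_goals try field_simp
    all_goals try ring
  · refine basic_open_aux d 0 3  1 0  0 1 0 0  0 0 1  1 0 0 ?_ ?_ ?_
    all_goals simp [coord]
    all_goals try field_simp
  · refine basic_open_aux d 1 0  1 0  0 1 0 0  0 d 1  1 0 0 ?_ ?_ ?_
    all_goals simp [coord]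
    all_goals try field_simp
  · refine basic_open_aux d 1 2  0 1  1 0 0 0  1 0 0  0 1 0 ?_ ?_ ?_
    all_goals simp [coord]
    all_goals try field_simp
  · refine basic_open_aux d 1 3  1 1  1 (d + 1) 0 0  1 0 (d + 1)  1 1 0 ?_ ?_ ?_
    all_goals simp [coord]
    all_goals try field_simp
    all_goals try ring
  · refine basic_open_aux d 2 0  1 1  1 1 d 0  1 0 1  (d + 1) 1 d ?_ ?_ ?_
    all_goals simp [coord]
    all_goals try field_simp
    all_goals try ring
  · refine basic_open_aux d 2 1  1 0  0 1 0 0  0 0 1  1 0 0 ?_ ?_ ?_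
    all_goals simp [coord]
    all_goals try field_simp
  · refine basic_open_aux d 2 3  0 1  1 0 0 0  1 0 0  d 1 0 ?_ ?_ ?_
    all_goals simp [coord]
    all_goals try field_simp
  · refine basic_open_aux d 3 0  0 1  1 0 0 0  1 0 0  0 1 0 ?_ ?_ ?_
    all_goals simp [coord]
    all_goals try field_simp
  · refine basic_open_aux d 3 1  1 1  1 1 0 d  (d + 1) d 1  1 1 0 ?_ ?_ ?_
    all_goals simp [coord]
    rotate_left
    · rw [mul_pow, inv_pow]
      field_simp
      ring
    all_goals try field_simp
  · refine basic_open_aux d 3 2  1 0  0 1 0 0  d 0 1  1 0 0 ?_ ?_ ?_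
    all_goals simp [coord]
    all_goals try field_simp

/-- Local equations of `div δ` on `U i` and `U j` differ by a unit on `U i ∩ U j`. -/
theorem localEquation_div_mem {d : ℕ} {δ : VectorField k} {i j : Fin 4} {α β : RatFun k}
    (hα : IsLocalEquation d δ i α) (hβ : IsLocalEquation d δ j β) :
    α / β ∈ overlap k d i j := by
  obtain ⟨hα0, f, g, hfg, hf, hg⟩ := hα
  obtain ⟨hβ0, f', g', -, hf', hg'⟩ := hβ
  have hle : chart k d i ≤ overlap k d i j := le_sup_left
  have hle' : chart k d j ≤ overlap k d i j := le_sup_right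
  have hj : ∀ r ∈ chart k d j, δ r / β ∈ overlap k d i j := by
    intro r hr
    have hr' := hr
    rw [chart] at hr'
    induction hr' using Algebra.adjoin_induction with
    | mem a ha =>
      obtain ⟨c, rfl⟩ := ha
      fin_cases c
      · refine hle' ?_
        have : δ (coord k d j 0) / β = f' := by rw [hf']; field_simp
        exact this ▸ f'.2
      · refine hle' ?_
        have : δ (coord k d j 1) / β = g' := by rw [hg']; field_simp
        exact this ▸ g'.2
    | algebraMap c => simp
    | add a b ha hb iha ihb =>
      rw [map_add, add_div]; exact add_mem (iha ha) (ihb hb)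
    | mul a b ha hb iha ihb =>
      rw [Derivation.leibniz, smul_eq_mul, smul_eq_mul, add_div, mul_div_assoc, mul_div_assoc]
      exact add_mem (mul_mem (hle' ha) (ihb hb)) (mul_mem (hle' hb) (iha ha))
  have hi : ∀ r ∈ overlap k d i j, δ r / β ∈ overlap k d i j := by
    intro r hr
    obtain ⟨m, hm, hm0, hinv, hex⟩ := exists_basic_open (k := k) d i j
    obtain ⟨n, hn⟩ := hex r hr
    have h1 := hj _ hn
    have h2 := hj _ (pow_mem hm n)
    have : δ r / β = (m⁻¹) ^ n * (δ (m ^ n * r) / β - r * (δ (m ^ n) / β)) := by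
      rw [Derivation.leibniz, smul_eq_mul, smul_eq_mul]
      rw [inv_pow]
      field_simp
      ring
    rw [this]
    exact mul_mem (pow_mem hinv n) (sub_mem h1 (mul_mem hr h2))
  obtain ⟨m, hm, hm0, hinv, hex⟩ := exists_basic_open (k := k) d j i
  have hcomm : overlap k d j i = overlap k d i j := sup_comm _ _
  rw [hcomm] at hinv hex
  have hA := hi _ (hle (coord_mem d i 0))
  have hB := hi _ (hle (coord_mem d i 1))
  obtain ⟨n, hn⟩ := hex _ hA
  obtain ⟨l, hl⟩ := hex _ hB
  suffices h : m ^ (n + l) * (α / β) ∈ chart k d i by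
    have e : α / β = (m⁻¹) ^ (n + l) * (m ^ (n + l) * (α / β)) := by
      rw [inv_pow, inv_mul_cancel_left₀ (pow_ne_zero _ hm0)]
    rw [e]
    exact mul_mem (pow_mem hinv _) (hle h)
  let A : chart k d i := ⟨m ^ l * (m ^ n * (δ (coord k d i 0) / β)), mul_mem (pow_mem hm l) hn⟩
  let B : chart k d i := ⟨m ^ n * (m ^ l * (δ (coord k d i 1) / β)), mul_mem (pow_mem hm n) hl⟩
  have eA : (A : RatFun k) = m ^ (n + l) * (α / β) * f := by
    simp only [A, hf]; ring
  have eB : (B : RatFun k) = m ^ (n + l) * (α / β) * g := by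
    simp only [B, hg]; ring
  have hAB : A * g = B * f := by
    apply Subtype.ext
    simp only [MulMemClass.coe_mul, eA, eB]
    ring
  by_cases hf0 : f = 0
  · subst hf0
    obtain ⟨v, hv⟩ := (isRelPrime_zero_left.1 hfg).exists_right_inv
    have hv' : (g : RatFun k) * v = 1 := congrArg Subtype.val hv
    have : m ^ (n + l) * (α / β) = ((B * v : chart k d i) : RatFun k) := by
      simp only [MulMemClass.coe_mul, eB]
      linear_combination -(m ^ (n + l) * (α / β)) * hv'
    rw [this]
    exact (B * v).2
  · obtain ⟨c, hc⟩ : f ∣ A := by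
      apply hfg.dvd_of_dvd_mul_right
      exact ⟨B, by rw [hAB, mul_comm]⟩
    have hf0' : (f : RatFun k) ≠ 0 := fun h => hf0 (Subtype.ext h)
    have : m ^ (n + l) * (α / β) = (c : RatFun k) := by
      apply mul_right_cancel₀ hf0'
      rw [← eA, hc, MulMemClass.coe_mul, mul_comm]
    rw [this]
    exact c.2

theorem exists_isDivisorOf (d : ℕ) {δ : VectorField k} (hδ : δ ≠ 0) :
    ∃ D : Divisor k d, IsDivisorOf δ D := by
  choose α hα using fun i => exists_isLocalEquation d i hδ
  exact ⟨⟨α, fun i => (hα i).1, fun i j => localEquation_div_mem (hα i) (hα j)⟩, hα⟩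

end WellDefined

/-- The divisor `div δ` of a nonzero rational vector field `δ`. Its local equation on `U i` is
determined up to units of the coordinate ring of `U i`, so that `O(div δ)` does not depend on
the choice. -/
def divisor {k : Type*} [Field k] (d : ℕ) (δ : VectorField k) (hδ : δ ≠ 0) : Divisor k d :=
  (exists_isDivisorOf d hδ).choose

theorem isDivisorOf_divisor {k : Type*} [Field k] (d : ℕ) (δ : VectorField k) (hδ : δ ≠ 0) :
    IsDivisorOf δ (divisor d δ hδ) :=
  (exists_isDivisorOf d hδ).choose_spec

/-- Each partial derivative of `k[x, y]` extends to the function field. -/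
theorem exists_partial (k : Type*) [Field k] (i : Fin 2) : ∃ D : VectorField k,
    ∀ p : MvPolynomial (Fin 2) k, D (algebraMap _ _ p) =
      algebraMap _ _ (MvPolynomial.pderiv i p) := by
  have := Algebra.FormallyEtale.of_isLocalization (Rₘ := RatFun k)
    (nonZeroDivisors (MvPolynomial (Fin 2) k))
  let e := KaehlerDifferential.tensorKaehlerEquivOfFormallyEtale k (MvPolynomial (Fin 2) k)
    (RatFun k)
  let D₀ : Derivation k (MvPolynomial (Fin 2) k) (RatFun k) :=
    (Algebra.linearMap (MvPolynomial (Fin 2) k) (RatFun k)).compDer (MvPolynomial.pderiv i)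
  let L : Ω[RatFun k⁄k] →ₗ[RatFun k] RatFun k :=
    (LinearMap.liftBaseChange (RatFun k) D₀.liftKaehlerDifferential) ∘ₗ e.symm.toLinearMap
  refine ⟨L.compDer (KaehlerDifferential.D k (RatFun k)), fun p => ?_⟩
  have h : e.symm (KaehlerDifferential.D k (RatFun k) (algebraMap _ _ p)) = _ :=
    KaehlerDifferential.tensorKaehlerEquivOfFormallyEtale_symm_D_algebraMap k
      (MvPolynomial (Fin 2) k) (RatFun k) p
  change L (KaehlerDifferential.D k (RatFun k) (algebraMap _ _ p)) = _
  simp only [L, LinearMap.comp_apply, LinearEquiv.coe_coe, h, LinearMap.liftBaseChange_tmul,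
    one_smul, Derivation.liftKaehlerDifferential_comp_D]
  rfl

/-- `∂/∂x` (for `i = 0`) and `∂/∂y` (for `i = 1`). -/
def partialDeriv (k : Type*) [Field k] (i : Fin 2) : VectorField k :=
  (exists_partial k i).choose

theorem partialDeriv_algebraMap {k : Type*} [Field k] (i : Fin 2) (p : MvPolynomial (Fin 2) k) :
    partialDeriv k i (algebraMap _ _ p) = algebraMap _ _ (MvPolynomial.pderiv i p) :=
  (exists_partial k i).choose_spec p

end Hirzebruch

end

/-!
Let `φ` be a nonzero global section of `O(div δ)`. Then `D = φ δ` is a vector field without poles,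
and one shows that `D` itself has the asserted form.

The coordinate axes of the four planes form four curves, whose complement is the torus with
coordinates `x`, `y`. So the regular functions on each plane are Laurent polynomials, and the order
of a Laurent polynomial along each of the four curves is read off its exponents through the rays of
the fan. If `c` is a coordinate of a plane, then the logarithmic derivative `D c / c` has at most a
simple pole along the curve `c = 0` and no pole along the other axis of this plane. Each of the four
curves meets a plane that has `x` or `x⁻¹` as a coordinate; together these planes show that
`D x / x` is a combination of `x`, `1` and `x⁻¹`, say with coefficients `a₂`, `a₁` and `a₀`.
Similarly `y` or `y⁻¹` is a coordinate near each of the curves, except the fibre `x = ∞`. Near that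
fibre `x ^ d y` is a coordinate instead, and `D y / y = D (x ^ d y) / (x ^ d y) - d D x / x`. Hence
`D y / y + d a₂ x` has no poles outside the two sections `y = 0` and `y = ∞`, where they are at most
simple, and comparing exponents leaves only the constants and the `x ^ a y` with `a ≤ d`.
-/

section LaurentMonomials

open scoped Matrix

variable {ι k L : Type*} [Fintype ι] [CommRing k] [Field L] [Algebra k L] {v : ι → L}

/-- The Laurent monomial `∏ i, v i ^ n i`; it is the character `χ ^ n` of the torus with
coordinates `v`. -/
def laurentMonomial (v : ι → L) (n : ι → ℤ) : L := ∏ i, v i ^ n i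

theorem laurentMonomial_zero (v : ι → L) : laurentMonomial v 0 = 1 := by
  simp [laurentMonomial]

theorem laurentMonomial_add (hv : ∀ i, v i ≠ 0) (m n : ι → ℤ) :
    laurentMonomial v (m + n) = laurentMonomial v m * laurentMonomial v n := by
  simp only [laurentMonomial, Pi.add_apply, zpow_add₀ (hv _), Finset.prod_mul_distrib]

theorem laurentMonomial_neg (v : ι → L) (n : ι → ℤ) :
    laurentMonomial v (-n) = (laurentMonomial v n)⁻¹ := by
  simp [laurentMonomial]

theorem laurentMonomial_ne_zero (hv : ∀ i, v i ≠ 0) (n : ι → ℤ) : laurentMonomial v n ≠ 0 :=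
  Finset.prod_ne_zero_iff.2 fun i _ => zpow_ne_zero _ (hv i)

theorem linearIndependent_laurentMonomial_natCast (hv : AlgebraicIndependent k v) :
    LinearIndependent k fun s : ι → ℕ => laurentMonomial v fun i => (s i : ℤ) := by
  have heq : (fun s : ι → ℕ => laurentMonomial v fun i => (s i : ℤ)) =
      (MvPolynomial.aeval v).toLinearMap ∘ MvPolynomial.basisMonomials ι k ∘
        Finsupp.equivFunOnFinite.symm := by
    funext s
    simp [laurentMonomial, MvPolynomial.aeval_monomial, Finsupp.prod_fintype]
  rw [heq]
  exact ((MvPolynomial.basisMonomials ι k).linearIndependent.comp _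
    Finsupp.equivFunOnFinite.symm.injective).map' _ (LinearMap.ker_eq_bot.2 hv)

theorem linearIndepOn_laurentMonomial_Ici (hv : AlgebraicIndependent k v) (N : ι → ℤ) :
    LinearIndepOn k (laurentMonomial v) (Set.Ici N) := by
  have : Nontrivial k := (algebraMap k L).domain_nontrivial
  let e : Set.Ici N → ι → ℕ := fun n i => (n.1 i - N i).toNat
  have he (n : Set.Ici N) : (n : ι → ℤ) = N + fun i => (e n i : ℤ) := by
    funext i
    have : N i ≤ n.1 i := n.2 i
    simp [e, this]
  have hinj : Function.Injective e := fun m n h => Subtype.ext (by rw [he m, he n, h])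
  -- Multiplying by `χ ^ (-N)` turns the exponents above `N` into natural numbers.
  have heq : (fun n : Set.Ici N => laurentMonomial v n) =
      LinearMap.mulLeft k (laurentMonomial v N) ∘
        (fun s : ι → ℕ => laurentMonomial v fun i => (s i : ℤ)) ∘ e := by
    funext n
    simp only [Function.comp_apply, LinearMap.mulLeft_apply]
    rw [← laurentMonomial_add hv.ne_zero, ← he]
  rw [LinearIndepOn, heq]
  exact ((linearIndependent_laurentMonomial_natCast hv).comp e hinj).map' _
    (LinearMap.ker_eq_bot.2 (mul_right_injective₀ (laurentMonomial_ne_zero hv.ne_zero N)))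

theorem linearIndependent_laurentMonomial (hv : AlgebraicIndependent k v) :
    LinearIndependent k (laurentMonomial v) := by
  have hdir : Directed (· ⊆ ·) (Set.Ici : (ι → ℤ) → Set (ι → ℤ)) := fun a b =>
    ⟨a ⊓ b, Set.Ici_subset_Ici.2 inf_le_left, Set.Ici_subset_Ici.2 inf_le_right⟩
  have hcover : ⋃ N : ι → ℤ, Set.Ici N = Set.univ :=
    Set.eq_univ_of_forall fun n => Set.mem_iUnion.2 ⟨n, Set.self_mem_Ici⟩
  rw [← linearIndepOn_univ_iff, ← hcover]
  exact linearIndepOn_iUnion_of_directed hdir (linearIndepOn_laurentMonomial_Ici hv)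

variable (k) in
/-- The Laurent polynomials in `v` that vanish to order at least `m` along the toric divisor with
ray `w`, that is, those all of whose exponents `n` satisfy `m ≤ ⟨w, n⟩`. -/
def orderGE (v : ι → L) (w : ι → ℤ) (m : ℤ) :
    Submodule k L :=
  Submodule.span k (laurentMonomial v '' {n | m ≤ w ⬝ᵥ n})

theorem laurentMonomial_mem_orderGE {w n : ι → ℤ} {m : ℤ} (h : m ≤ w ⬝ᵥ n) :
    laurentMonomial v n ∈ orderGE k v w m :=
  Submodule.subset_span ⟨n, h, rfl⟩

theorem one_mem_orderGE {w : ι → ℤ} : 1 ∈ orderGE k v w 0 :=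
  laurentMonomial_zero v ▸ laurentMonomial_mem_orderGE (dotProduct_zero w).ge

theorem mul_mem_orderGE (hv : ∀ i, v i ≠ 0) {w : ι → ℤ} {m n : ℤ} {f g : L}
    (hf : f ∈ orderGE k v w m) (hg : g ∈ orderGE k v w n) : f * g ∈ orderGE k v w (m + n) := by
  have hle : orderGE k v w m * orderGE k v w n ≤ orderGE k v w (m + n) := by
    rw [orderGE, orderGE, Submodule.span_mul_span, Submodule.span_le]
    rintro _ ⟨_, ⟨a, ha, rfl⟩, _, ⟨b, hb, rfl⟩, rfl⟩
    dsimp only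
    rw [← laurentMonomial_add hv]
    exact laurentMonomial_mem_orderGE ((add_le_add ha hb).trans_eq (dotProduct_add w a b).symm)
  exact hle (Submodule.mul_mem_mul hf hg)

theorem mem_orderGE_of_mem_adjoin (hv : ∀ i, v i ≠ 0) {w : ι → ℤ} {s : Set L}
    (hs : s ⊆ orderGE k v w 0) {f : L} (hf : f ∈ Algebra.adjoin k s) : f ∈ orderGE k v w 0 := by
  let S := (orderGE k v w 0).toSubalgebra one_mem_orderGE fun _ _ => mul_mem_orderGE hv
  exact Algebra.adjoin_le (S := S) hs hf

theorem mem_span_laurentMonomial_of_forall_mem_orderGE (hv : AlgebraicIndependent k v)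
    {J : Type*} [Nonempty J] {w : J → ι → ℤ} {m : J → ℤ} {f : L}
    (hf : ∀ j, f ∈ orderGE k v (w j) (m j)) :
    f ∈ Submodule.span k (laurentMonomial v '' {n | ∀ j, m j ≤ w j ⬝ᵥ n}) := by
  have hinf := (Submodule.mem_iInf _).2 hf
  simp only [orderGE, Finsupp.span_image_eq_map_linearCombination] at hinf
  rwa [← Submodule.map_iInf _ (linearIndependent_laurentMonomial hv), ← Finsupp.supported_iInter,
    ← Finsupp.span_image_eq_map_linearCombination, ← Set.ofPred_forall] at hinf

end LaurentMonomials

theorem exists_polynomial_of_mem_span_pow_mul {R A : Type*} [CommSemiring R] [Semiring A]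
    [Algebra R A] {t s f : A} {d : ℕ}
    (hf : f ∈ Submodule.span R ((fun a : ℕ => t ^ a * s) '' Set.Iic d)) :
    ∃ F : Polynomial R, F.degree ≤ d ∧ f = Polynomial.aeval t F * s := by
  classical
  let φ : Polynomial R →ₗ[R] A := LinearMap.mulRight R s ∘ₗ (Polynomial.aeval t).toLinearMap
  suffices h : f ∈ (Polynomial.degreeLE R d).map φ by
    obtain ⟨F, hF, rfl⟩ := h
    exact ⟨F, Polynomial.mem_degreeLE.1 hF, rfl⟩
  refine Submodule.span_le.2 ?_ hf
  rintro _ ⟨a, ha, rfl⟩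
  refine ⟨Polynomial.X ^ a, Polynomial.mem_degreeLE.2 ?_, by simp [φ]⟩
  exact (Polynomial.degree_X_pow_le a).trans (by exact_mod_cast ha)

section LogarithmicDerivative

variable {R K : Type*} [CommRing R] [Field K] [Algebra R K] (D : Derivation R K K)

/-- The logarithmic derivative `D a / a` of `a` along the derivation `D`. -/
def dlog (a : K) : K := D a / a

variable {D} in
theorem mul_dlog {a : K} (ha : a ≠ 0) : a * dlog D a = D a :=
  mul_div_cancel₀ _ ha

theorem dlog_inv (a : K) : dlog D a⁻¹ = -dlog D a := by
  by_cases ha : a = 0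
  · simp [dlog, ha]
  · rw [dlog, dlog, Derivation.leibniz_inv, smul_eq_mul]
    field_simp

theorem dlog_mul {a b : K} (ha : a ≠ 0) (hb : b ≠ 0) : dlog D (a * b) = dlog D a + dlog D b := by
  rw [dlog, dlog, dlog, Derivation.leibniz, smul_eq_mul, smul_eq_mul]
  field_simp
  ring

theorem dlog_pow (a : K) (n : ℕ) : dlog D (a ^ n) = n * dlog D a := by
  by_cases ha : a = 0
  · rcases n.eq_zero_or_pos with rfl | hn
    · simp [dlog]
    · simp [dlog, ha, hn.ne']
  · induction n with
    | zero => simp [dlog]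
    | succ n ih => rw [pow_succ, dlog_mul D (pow_ne_zero n ha) ha, ih, Nat.cast_succ]; ring

end LogarithmicDerivative

namespace Hirzebruch

open scoped Matrix

variable {k : Type*} [Field k] {d : ℕ}

section Toric

/-- The rays of the fan of the Hirzebruch surface, in cyclic order. They correspond to the four
torus-invariant curves; in `U i`, the coordinate axis where coordinate `j` vanishes is the curve
with ray `i + j`. -/
def ray (d : ℕ) : Fin 4 → Fin 2 → ℤ :=
  ![![1, 0], ![0, 1], ![-1, d], ![0, -1]]

/-- The coordinates of the four planes as Laurent monomials in `x` and `y`, through their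
exponents. -/
def coordExponent (d : ℕ) : Fin 4 → Fin 2 → Fin 2 → ℤ :=
  ![![![1, 0], ![0, 1]],
    ![![d, 1], ![-1, 0]],
    ![![-1, 0], ![-d, -1]],
    ![![0, -1], ![1, 0]]]

theorem coord_eq_laurentMonomial (i : Fin 4) (j : Fin 2) :
    coord k d i j = laurentMonomial ![x k, y k] (coordExponent d i j) := by
  fin_cases i <;> fin_cases j <;> simp [coord, coordExponent, laurentMonomial, mul_comm]

theorem ray_dotProduct_coordExponent (i : Fin 4) (j c : Fin 2) :
    ray d (![i, i + 1] j) ⬝ᵥ coordExponent d i c = if j = c then 1 else 0 := by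
  fin_cases i <;> fin_cases j <;> fin_cases c <;> simp [ray, coordExponent]

theorem algebraicIndependent_x_y : AlgebraicIndependent k ![x k, y k] :=
  algebraicIndependent_coord 0 0

variable (k d) in
/-- The Laurent polynomials in `x` and `y` that vanish to order at least `m` along the `j`-th
torus-invariant curve. -/
noncomputable abbrev curveOrderGE (j : Fin 4) (m : ℤ) : Submodule k (RatFun k) :=
  orderGE k ![x k, y k] (ray d j) m

theorem mem_curveOrderGE_of_mem_chart {i : Fin 4} {f : RatFun k} (hf : f ∈ chart k d i)
    (j : Fin 2) : f ∈ curveOrderGE k d (![i, i + 1] j) 0 := by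
  refine mem_orderGE_of_mem_adjoin algebraicIndependent_x_y.ne_zero ?_ hf
  rintro _ ⟨c, rfl⟩
  rw [coord_eq_laurentMonomial]
  refine laurentMonomial_mem_orderGE ?_
  rw [ray_dotProduct_coordExponent]
  split_ifs <;> decide

theorem mem_span_laurentMonomial_of_forall_mem_curveOrderGE {f : RatFun k} {m : Fin 4 → ℤ}
    (hf : ∀ j, f ∈ curveOrderGE k d j (m j)) :
    f ∈ Submodule.span k (laurentMonomial ![x k, y k] ''
      {n : Fin 2 → ℤ | m 0 ≤ n 0 ∧ m 1 ≤ n 1 ∧ m 2 ≤ d * n 1 - n 0 ∧ m 3 ≤ -n 1}) := by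
  have h := mem_span_laurentMonomial_of_forall_mem_orderGE (k := k) (v := ![x k, y k])
    (w := ray d) (m := m) algebraicIndependent_x_y hf
  refine Submodule.span_mono (Set.image_mono fun (n : Fin 2 → ℤ) hn => ?_) h
  have h0 := hn 0
  have h1 := hn 1
  have h2 := hn 2
  have h3 := hn 3
  simp only [ray, Matrix.vec2_dotProduct, Matrix.cons_val] at h0 h1 h2 h3
  refine ⟨?_, ?_, ?_, ?_⟩ <;> linarith

end Toric

theorem eq_smul_partialDeriv_add_smul_partialDeriv (D : VectorField k) :
    D = D (x k) • partialDeriv k 0 + D (y k) • partialDeriv k 1 := by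
  have hx (i : Fin 2) : partialDeriv k i (x k) = if i = 0 then 1 else 0 := by
    rw [x, partialDeriv_algebraMap, MvPolynomial.pderiv_X]
    fin_cases i <;> simp
  have hy (i : Fin 2) : partialDeriv k i (y k) = if i = 1 then 1 else 0 := by
    rw [y, partialDeriv_algebraMap, MvPolynomial.pderiv_X]
    fin_cases i <;> simp
  refine sub_eq_zero.1 (eq_zero_of_coord 0 0 _ ?_ ?_) <;> simp [coord, hx, hy]

/-- A rational vector field without poles on the Hirzebruch surface: on each plane, its coefficients
in the partial derivatives along the coordinates are regular. -/
def IsRegular (d : ℕ) (D : VectorField k) : Prop :=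
  ∀ i j, D (coord k d i j) ∈ chart k d i

theorem IsDivisorOf.isRegular_smul {δ : VectorField k} {E : Divisor k d} (hE : IsDivisorOf δ E)
    {φ : RatFun k} (hφ : φ ∈ E.globalSections) : IsRegular d (φ • δ) := by
  intro i j
  obtain ⟨hα, f, g, -, hf, hg⟩ := hE i
  obtain ⟨h, hh, rfl⟩ := (Submodule.mem_iInf _).1 hφ i
  have hcancel (r : RatFun k) : (h / E.eqn i) • (E.eqn i * r) = h * r := by
    rw [smul_eq_mul, ← mul_assoc, div_mul_cancel₀ h hα]
  rw [Derivation.smul_apply]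
  fin_cases j
  · exact hf ▸ hcancel f ▸ mul_mem hh f.2
  · exact hg ▸ hcancel g ▸ mul_mem hh g.2

namespace IsRegular

variable {D : VectorField k}

theorem dlog_coord_mem (hD : IsRegular d D) (i : Fin 4) (c j : Fin 2) :
    dlog D (coord k d i c) ∈ curveOrderGE k d (![i, i + 1] j) (if j = c then -1 else 0) := by
  have hinv : (coord k d i c)⁻¹ ∈
      curveOrderGE k d (![i, i + 1] j) (if j = c then -1 else 0) := by
    rw [coord_eq_laurentMonomial, ← laurentMonomial_neg]
    refine laurentMonomial_mem_orderGE ?_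
    rw [dotProduct_neg, ray_dotProduct_coordExponent]
    split_ifs <;> decide
  simpa [dlog, div_eq_mul_inv] using mul_mem_orderGE algebraicIndependent_x_y.ne_zero
    (mem_curveOrderGE_of_mem_chart (hD i c) j) hinv

theorem dlog_x_mem (hD : IsRegular d D) (j : Fin 4) :
    dlog D (x k) ∈ curveOrderGE k d j (![-1, 0, -1, 0] j) := by
  fin_cases j
  · exact hD.dlog_coord_mem 0 0 0
  · exact hD.dlog_coord_mem 0 0 1
  · have h : dlog D (x k)⁻¹ ∈ curveOrderGE k d 2 (-1) := hD.dlog_coord_mem 1 1 1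
    rwa [dlog_inv, neg_mem_iff] at h
  · exact hD.dlog_coord_mem 3 1 0

theorem exists_dlog_x_eq (hD : IsRegular d D) :
    ∃ a₀ a₁ a₂ : k, dlog D (x k) = a₂ • x k + a₁ • 1 + a₀ • (x k)⁻¹ := by
  suffices h : dlog D (x k) ∈ Submodule.span k {x k, 1, (x k)⁻¹} by
    obtain ⟨a₂, a₁, a₀, h⟩ := Submodule.mem_span_triple.1 h
    exact ⟨a₀, a₁, a₂, h.symm⟩
  refine Submodule.span_mono ?_ (mem_span_laurentMonomial_of_forall_mem_curveOrderGE hD.dlog_x_mem)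
  rintro _ ⟨n, ⟨h0, h1, h2, h3⟩, rfl⟩
  simp only [Matrix.cons_val] at h0 h1 h2 h3
  have hn1 : n 1 = 0 := by omega
  rw [hn1] at h2
  obtain hn0 | hn0 | hn0 : n 0 = 1 ∨ n 0 = 0 ∨ n 0 = -1 := by omega
  all_goals simp [laurentMonomial, hn0, hn1]

theorem dlog_y_add_mem (hD : IsRegular d D) {a₀ a₁ a₂ : k}
    (hx : dlog D (x k) = a₂ • x k + a₁ • 1 + a₀ • (x k)⁻¹) (j : Fin 4) :
    dlog D (y k) + ((d : k) * a₂) • x k ∈ curveOrderGE k d j (![0, -1, 0, -1] j) := by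
  have hx_mem {j : Fin 4} {m : ℤ} (h : m ≤ ray d j ⬝ᵥ ![1, 0]) (c : k) :
      c • x k ∈ curveOrderGE k d j m := by
    simpa [laurentMonomial] using
      Submodule.smul_mem _ c (laurentMonomial_mem_orderGE (v := ![x k, y k]) h)
  fin_cases j
  · exact add_mem (hD.dlog_coord_mem 0 1 0) (hx_mem (by simp [ray]) _)
  · exact add_mem (hD.dlog_coord_mem 0 1 1) (hx_mem (by simp [ray]) _)
  · have heq : dlog D (y k) + ((d : k) * a₂) • x k =
        dlog D (x k ^ d * y k) - ((d : k) * a₁) • 1 - ((d : k) * a₀) • (x k)⁻¹ := by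
      rw [dlog_mul D (pow_ne_zero d x_ne_zero) y_ne_zero, dlog_pow, hx]
      simp only [Algebra.smul_def, map_mul, map_natCast]
      ring
    have hz : dlog D (x k ^ d * y k) ∈ curveOrderGE k d 2 0 := hD.dlog_coord_mem 1 0 1
    have hinv : (x k)⁻¹ ∈ curveOrderGE k d 2 0 := mem_curveOrderGE_of_mem_chart (coord_mem d 1 1) 1
    rw [heq]
    exact sub_mem (sub_mem hz (Submodule.smul_mem _ _ one_mem_orderGE))
      (Submodule.smul_mem _ _ hinv)
  · have h : dlog D (y k)⁻¹ ∈ curveOrderGE k d 3 (-1) := hD.dlog_coord_mem 3 0 0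
    rw [dlog_inv, neg_mem_iff] at h
    exact add_mem h (hx_mem (by simp [ray]) _)

theorem exists_dlog_y_eq (hd : 1 ≤ d) (hD : IsRegular d D) {a₀ a₁ a₂ : k}
    (hx : dlog D (x k) = a₂ • x k + a₁ • 1 + a₀ • (x k)⁻¹) :
    ∃ (b : k) (F : Polynomial k), F.degree ≤ d ∧
      dlog D (y k) = Polynomial.aeval (x k) F * y k - ((d : k) * a₂) • x k + algebraMap k _ b := by
  have hmem := mem_span_laurentMonomial_of_forall_mem_curveOrderGE (hD.dlog_y_add_mem hx)
  suffices h : dlog D (y k) + ((d : k) * a₂) • x k ∈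
      Submodule.span k ({1} ∪ (fun a : ℕ => x k ^ a * y k) '' Set.Iic d) by
    rw [Submodule.span_union, Submodule.mem_sup] at h
    obtain ⟨_, hb, _, hF, h⟩ := h
    obtain ⟨b, rfl⟩ := Submodule.mem_span_singleton.1 hb
    obtain ⟨F, hdeg, rfl⟩ := exists_polynomial_of_mem_span_pow_mul hF
    refine ⟨b, F, hdeg, ?_⟩
    rw [← Algebra.algebraMap_eq_smul_one] at h
    linear_combination -h
  refine Submodule.span_mono ?_ hmem
  rintro _ ⟨n, ⟨h0, h1, h2, h3⟩, rfl⟩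
  simp only [Matrix.cons_val] at h0 h1 h2 h3
  obtain hn1 | hn1 | hn1 : n 1 = -1 ∨ n 1 = 0 ∨ n 1 = 1 := by omega
  all_goals rw [hn1] at h2
  · -- `x ^ a y⁻¹` with `a ≥ 0` has a pole of order at least `d ≥ 1` along the fibre `x = ∞`.
    omega
  · left
    have hn0 : n 0 = 0 := by omega
    simp [laurentMonomial, hn0, hn1]
  · right
    obtain ⟨a, ha⟩ := Int.eq_ofNat_of_zero_le h0
    refine ⟨a, Set.mem_Iic.2 (by omega), ?_⟩
    simp [laurentMonomial, hn1, ha]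

theorem exists_eq_smul_partialDeriv_add (hd : 1 ≤ d) (hD : IsRegular d D) :
    ∃ (a₀ a₁ a₂ b : k) (F : Polynomial k), F.degree ≤ d ∧
      D = (a₂ • x k ^ 2 + a₁ • x k + algebraMap k _ a₀) • partialDeriv k 0 +
        ((Polynomial.aeval (x k) F * y k - ((d : k) * a₂) • x k + algebraMap k _ b) * y k) •
          partialDeriv k 1 := by
  obtain ⟨a₀, a₁, a₂, hx⟩ := hD.exists_dlog_x_eq
  obtain ⟨b, F, hF, hy⟩ := hD.exists_dlog_y_eq hd hx
  refine ⟨a₀, a₁, a₂, b, F, hF, ?_⟩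
  have hx0 := x_ne_zero (k := k)
  have hDx : D (x k) = a₂ • x k ^ 2 + a₁ • x k + algebraMap k _ a₀ := by
    rw [← mul_dlog hx0, hx]
    simp only [Algebra.smul_def]
    field_simp
  have hDy : D (y k) = (Polynomial.aeval (x k) F * y k - ((d : k) * a₂) • x k +
      algebraMap k _ b) * y k := by
    rw [← mul_dlog y_ne_zero, hy, mul_comm]
  rw [← hDx, ← hDy, ← eq_smul_partialDeriv_add_smul_partialDeriv]

end IsRegular

end Hirzebruch

theorem lemma2p3_general {k : Type*} [Field k] (d : ℕ) (hd : 1 ≤ d) (δ : Hirzebruch.VectorField k)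
    (hδ : δ ≠ 0) (hsec : ∃ φ ∈ (Hirzebruch.divisor d δ hδ).globalSections, φ ≠ 0) :
    ∃ (a₀ a₁ a₂ b : k) (F : Polynomial k), F.degree ≤ d ∧
      Hirzebruch.Equivalent δ
        ((a₂ • Hirzebruch.x k ^ 2 + a₁ • Hirzebruch.x k + algebraMap k _ a₀) •
            Hirzebruch.partialDeriv k 0 +
          ((Polynomial.aeval (Hirzebruch.x k) F * Hirzebruch.y k -
              ((d : k) * a₂) • Hirzebruch.x k + algebraMap k _ b) * Hirzebruch.y k) •
            Hirzebruch.partialDeriv k 1) := by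
  obtain ⟨φ, hφ, hφ0⟩ := hsec
  have hreg : Hirzebruch.IsRegular d (φ • δ) :=
    (Hirzebruch.isDivisorOf_divisor d δ hδ).isRegular_smul hφ
  obtain ⟨a₀, a₁, a₂, b, F, hF, h⟩ := hreg.exists_eq_smul_partialDeriv_add hd
  exact ⟨a₀, a₁, a₂, b, F, hF, φ⁻¹, inv_ne_zero hφ0, by rw [← h, inv_smul_smul₀ hφ0]⟩

theorem lemma2p3 {k : Type*} [Field k] [IsAlgClosed k] (p : ℕ) [Fact p.Prime] [CharP k p]
    (d : ℕ) (hd : 1 ≤ d) (δ : Hirzebruch.VectorField k) (hδ : δ ≠ 0)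
    (hsec : ∃ φ ∈ (Hirzebruch.divisor d δ hδ).globalSections, φ ≠ 0) :
    ∃ (a₀ a₁ a₂ b : k) (F : Polynomial k), F.degree ≤ d ∧
      Hirzebruch.Equivalent δ
        ((a₂ • Hirzebruch.x k ^ 2 + a₁ • Hirzebruch.x k + algebraMap k _ a₀) •
            Hirzebruch.partialDeriv k 0 +
          ((Polynomial.aeval (Hirzebruch.x k) F * Hirzebruch.y k -
              ((d : k) * a₂) • Hirzebruch.x k + algebraMap k _ b) * Hirzebruch.y k) •
            Hirzebruch.partialDeriv k 1) :=
  lemma2p3_general d hd δ hδ hsec
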